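/- Let $(Z,d)$ be a complete, separable, locally compact, geodesic metric space with base point $e\in Z$. For $q>0$ let $\mathcal M_q(Z)$ be the space of finite signed Borel measures $\mu$ on $Z$ with $\int_Z d(z,e)^q\,\mathrm d|\mu|(z)<\infty$, and equip $\mathcal M_1(Z)$ with the norm $$\|\mu\|_{\mathrm{KRu}}=|\mu(Z)|+\sup\Big\{\int_Z f\,\mathrm d\mu : f\colon Z\to\mathbb R,\ f(e)=0,\ \mathrm{Lip}(f)\le 1\Big\}.$$ Let $\mathrm{KRu}(Z)$ be the completion of $(\mathcal M_1(Z),\|\cdot\|_{\mathrm{KRu}})$. For $p>1$, $\alpha\ge 0$ and $\beta>0$ define $G_{\alpha,\beta}\colon \mathrm{KRu}(Z)\to[0,\infty]$ by $$G_{\alpha,\beta}(\mu)=\alpha\|\mu\|_{\mathrm{KRu}}+\beta\int_Z\big(1+d(z,e)^p\big)\,\mathrm d|\mu|(z)\quad\text{if }\mu\in\mathcal M_p(Z)\ (\subseteq\mathcal M_1(Z)\subseteq\mathrm{KRu}(Z)),$$ and $G_{\alpha,\beta}(\mu)=+\infty$ otherwise. **Theorem.** Let $p>1$, $\alpha\ge0$,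 $\beta>0$. Then: 1. $G_{\alpha,\beta}$ is lower semicontinuous on $\mathrm{KRu}(Z)$ with respect to the norm $\|\cdot\|_{\mathrm{KRu}}$. 2. For every $t\in[0,\infty)$ the sublevel set $\{\mu\in\mathrm{KRu}(Z): G_{\alpha,\beta}(\mu)\le t\}$ is compact in the norm topology of $\mathrm{KRu}(Z)$. 3. For every real Hilbert space $H$, every continuous linear operator $\mathcal A\colon\mathrm{KRu}(Z)\to H$ and every functional $F\colon H\to(-\infty,+\infty]$ that is proper (not identically $+\infty$), convex, coercive ($F(x)\to+\infty$ as $\|x\|\to\infty$) and lower semicontinuous, the problem $$\inf_{\mu\in\mathrm{KRu}(Z)} F(\mathcal A\mu)+G_{\alpha,\beta}(\mu)$$ admits a minimizer, i.e. there is $\mu_0\in\mathrm{KRu}(Z)$ with $F(\mathcal A\mu_0)+G_{\alpha,\beta}(\mu_0)\le F(\mathcal A\mu)+G_{\alpha,\beta}(\mu)$ for all $\mu\in\mathrm{KRu}(Z)$ (as an inequality in $(-\infty,+\infty]$). -/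

import Mathlib

open MeasureTheory Filter Topology
open scoped ENNReal NNReal

noncomputable section

/-- A metric space is geodesic if any two points `x`, `y` are joined by an isometric image of the
interval `[0, d(x, y)]`. -/
def IsGeodesicSpace (Z : Type*) [MetricSpace Z] : Prop :=
  ∀ x y : Z, ∃ γ : ℝ → Z, γ 0 = x ∧ γ (dist x y) = y ∧
    ∀ s ∈ Set.Icc 0 (dist x y), ∀ t ∈ Set.Icc 0 (dist x y), dist (γ s) (γ t) = |s - t|

namespace KRSpace

section Measures

variable {Z : Type*} [MetricSpace Z] [MeasurableSpace Z] [BorelSpace Z]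

instance isFiniteMeasure_variation (μ : SignedMeasure Z) : IsFiniteMeasure μ.variation := by
  rw [← SignedMeasure.totalVariation_eq_variation]
  infer_instance

/-- `𝓜_q(Z)`: the finite signed Borel measures `μ` on `Z` with `∫ d(z, e)^q d|μ|(z) < ∞`. -/
def momentMeasures (e : Z) (q : ℝ) : Submodule ℝ (SignedMeasure Z) where
  carrier := {μ | ∫⁻ z, edist z e ^ q ∂μ.variation < ∞}
  zero_mem' := by simp
  add_mem' := by
    intro μ ν hμ hν
    refine lt_of_le_of_lt (lintegral_mono' VectorMeasure.variation_add_le le_rfl) ?_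
    rw [lintegral_add_measure]
    exact ENNReal.add_lt_top.2 ⟨hμ, hν⟩
  smul_mem' := by
    intro c μ hμ
    have h : (c • μ).variation = ‖c‖₊ • μ.variation := VectorMeasure.variation_smul
    simp only [Set.mem_ofPred_eq, h]
    rw [lintegral_smul_measure]
    exact ENNReal.mul_lt_top ENNReal.coe_lt_top hμ

/-- `𝓜₁(Z)`: the finite signed Borel measures on `Z` with finite first moment. -/
abbrev M1 (e : Z) : Submodule ℝ (SignedMeasure Z) := momentMeasures e 1

/-- The values `∫ f dμ` for `f : Z → ℝ` with `f(e) = 0` and Lipschitz constant at most `1`. -/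
def lipPairings (e : Z) (μ : SignedMeasure Z) : Set ℝ :=
  {r | ∃ f : Z → ℝ, f e = 0 ∧ LipschitzWith 1 f ∧ r = ∫ᵛ z, f z ∂<•μ}

/-- The unbalanced Kantorovich-Rubinstein norm
`|μ(Z)| + sup {∫ f dμ : f(e) = 0, L(f) ≤ 1}` on `𝓜₁(Z)`. -/
instance instNormM1 (e : Z) : Norm (M1 e) where
  norm μ := |(μ : SignedMeasure Z) Set.univ| + sSup (lipPairings e μ)

theorem norm_def (e : Z) (μ : M1 e) :
    ‖μ‖ = |(μ : SignedMeasure Z) Set.univ| + sSup (lipPairings e μ) := rfl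

theorem integrable_of_lipschitz {e : Z} (μ : M1 e) {f : Z → ℝ} {K : ℝ≥0}
    (hf : LipschitzWith K f) : (μ : SignedMeasure Z).Integrable f := by
  have hd : Integrable (fun z => dist z e) (μ : SignedMeasure Z).variation := by
    refine ⟨(continuous_id.dist continuous_const).aestronglyMeasurable, ?_⟩
    have h : ∫⁻ z, edist z e ^ (1 : ℝ) ∂(μ : SignedMeasure Z).variation < ∞ := μ.2
    simpa [HasFiniteIntegral, edist_dist, Real.enorm_eq_ofReal] using h
  refine Integrable.mono' (((hd.const_mul (K : ℝ)).add (integrable_const |f e|)))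
    hf.continuous.aestronglyMeasurable (Eventually.of_forall fun z => ?_)
  have h := hf.dist_le_mul z e
  rw [Real.dist_eq] at h
  simp only [Real.norm_eq_abs, Pi.add_apply]
  linarith [abs_sub_abs_le_abs_sub (f z) (f e)]

theorem lipPairings_nonempty (e : Z) (μ : SignedMeasure Z) : (lipPairings e μ).Nonempty :=
  ⟨0, fun _ => 0, rfl, LipschitzWith.const' 0, by simp⟩

theorem lipPairings_bddAbove {e : Z} (μ : M1 e) : BddAbove (lipPairings e (μ : SignedMeasure Z)) := by
  refine ⟨‖(ContinuousLinearMap.lsmul ℝ ℝ (E := ℝ)).flip‖ *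
    ∫ z, dist z e ∂(μ : SignedMeasure Z).variation, ?_⟩
  rintro r ⟨f, hfe, hf, rfl⟩
  refine (le_abs_self _).trans ((Real.norm_eq_abs _).symm.le.trans
    ((VectorMeasure.norm_integral_le_integral_norm).trans ?_))
  gcongr
  · exact (integrable_of_lipschitz μ hf).norm
  · have h := integrable_of_lipschitz μ (LipschitzWith.dist_left e)
    exact h
  · intro z
    simpa [hfe, Real.dist_eq] using hf.dist_le_mul z e

theorem sSup_lipPairings_nonneg {e : Z} (μ : M1 e) :
    0 ≤ sSup (lipPairings e (μ : SignedMeasure Z)) :=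
  le_csSup (lipPairings_bddAbove μ) ⟨fun _ => 0, rfl, LipschitzWith.const' 0, by simp⟩

theorem integral_le_sSup {e : Z} (μ : M1 e) {f : Z → ℝ} (hfe : f e = 0) (hf : LipschitzWith 1 f) :
    ∫ᵛ z, f z ∂<•(μ : SignedMeasure Z) ≤ sSup (lipPairings e (μ : SignedMeasure Z)) :=
  le_csSup (lipPairings_bddAbove μ) ⟨f, hfe, hf, rfl⟩

theorem norm_add_le_aux {e : Z} (μ ν : M1 e) : ‖μ + ν‖ ≤ ‖μ‖ + ‖ν‖ := by
  have h1 : sSup (lipPairings e ((μ + ν : M1 e) : SignedMeasure Z)) ≤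
      sSup (lipPairings e (μ : SignedMeasure Z)) + sSup (lipPairings e (ν : SignedMeasure Z)) := by
    refine csSup_le (lipPairings_nonempty e _) ?_
    rintro r ⟨f, hfe, hf, rfl⟩
    rw [Submodule.coe_add, VectorMeasure.integral_add_vectorMeasure
      (integrable_of_lipschitz μ hf) (integrable_of_lipschitz ν hf)]
    exact add_le_add (integral_le_sSup μ hfe hf) (integral_le_sSup ν hfe hf)
  have h2 : |((μ + ν : M1 e) : SignedMeasure Z) Set.univ| ≤
      |(μ : SignedMeasure Z) Set.univ| + |(ν : SignedMeasure Z) Set.univ| := by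
    simpa using abs_add_le ((μ : SignedMeasure Z) Set.univ) ((ν : SignedMeasure Z) Set.univ)
  rw [norm_def, norm_def, norm_def]
  linarith

theorem norm_smul_le_aux {e : Z} (c : ℝ) (μ : M1 e) : ‖c • μ‖ ≤ |c| * ‖μ‖ := by
  have h1 : sSup (lipPairings e ((c • μ : M1 e) : SignedMeasure Z)) ≤
      |c| * sSup (lipPairings e (μ : SignedMeasure Z)) := by
    refine csSup_le (lipPairings_nonempty e _) ?_
    rintro r ⟨f, hfe, hf, rfl⟩
    rw [Submodule.coe_smul, VectorMeasure.integral_smul_vectorMeasure, smul_eq_mul]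
    rcases le_total 0 c with hc | hc
    · rw [abs_of_nonneg hc]
      exact mul_le_mul_of_nonneg_left (integral_le_sSup μ hfe hf) hc
    · have h := integral_le_sSup μ (f := fun z => -f z) (by simp [hfe]) hf.neg
      rw [VectorMeasure.integral_fun_neg] at h
      rw [abs_of_nonpos hc]
      nlinarith
  have h2 : |((c • μ : M1 e) : SignedMeasure Z) Set.univ| =
      |c| * |(μ : SignedMeasure Z) Set.univ| := by
    simp [abs_mul]
  rw [norm_def, norm_def, h2]
  linarith

theorem integral_eq_jordan (μ : SignedMeasure Z) {f : Z → ℝ} (hf : μ.Integrable f) :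
    ∫ᵛ z, f z ∂<•μ = ∫ z, f z ∂μ.toJordanDecomposition.posPart -
      ∫ z, f z ∂μ.toJordanDecomposition.negPart := by
  have h : MeasureTheory.Integrable f
      (μ.toJordanDecomposition.posPart + μ.toJordanDecomposition.negPart) := by
    have := hf
    rw [VectorMeasure.Integrable, ← SignedMeasure.totalVariation_eq_variation] at this
    exact this
  conv_lhs => rw [← SignedMeasure.toSignedMeasure_toJordanDecomposition μ]
  rw [JordanDecomposition.toSignedMeasure, VectorMeasure.integral_sub_vectorMeasure,
    VectorMeasure.integral_toSignedMeasure, VectorMeasure.integral_toSignedMeasure]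
  · simpa [VectorMeasure.Integrable] using h.left_of_add_measure
  · simpa [VectorMeasure.Integrable] using h.right_of_add_measure

/-- The Kantorovich-Rubinstein norm separates the points of `𝓜₁(Z)`. -/
theorem eq_zero_of_norm_eq_zero {e : Z} (μ : M1 e) (h : ‖μ‖ = 0) : μ = 0 := by
  rw [norm_def] at h
  have hs := sSup_lipPairings_nonneg μ
  have hm : (μ : SignedMeasure Z) Set.univ = 0 :=
    abs_eq_zero.1 (by linarith [abs_nonneg ((μ : SignedMeasure Z) Set.univ)])
  have hs0 : sSup (lipPairings e (μ : SignedMeasure Z)) = 0 := by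
    linarith [abs_nonneg ((μ : SignedMeasure Z) Set.univ)]
  have h1 : ∀ f : Z → ℝ, f e = 0 → LipschitzWith 1 f → ∫ᵛ z, f z ∂<•(μ : SignedMeasure Z) = 0 := by
    intro f hfe hf
    have ha := integral_le_sSup μ hfe hf
    have hb := integral_le_sSup μ (f := fun z => -f z) (by simp [hfe]) hf.neg
    rw [VectorMeasure.integral_fun_neg] at hb
    linarith
  have h2 : ∀ (f : Z → ℝ) (K : ℝ≥0), LipschitzWith K f →
      ∫ᵛ z, f z ∂<•(μ : SignedMeasure Z) = 0 := by
    intro f K hf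
    have hK : (0 : ℝ) < K + 1 := by positivity
    have hg : LipschitzWith 1 fun z => ((K : ℝ) + 1)⁻¹ • (f z - f e) := by
      refine LipschitzWith.of_dist_le_mul fun x y => ?_
      have := hf.dist_le_mul x y
      rw [Real.dist_eq] at this ⊢
      have hxy : ((K : ℝ) + 1)⁻¹ • (f x - f e) - ((K : ℝ) + 1)⁻¹ • (f y - f e) =
          ((K : ℝ) + 1)⁻¹ * (f x - f y) := by simp only [smul_eq_mul]; ring
      rw [hxy, abs_mul, abs_of_pos (inv_pos.2 hK), inv_mul_le_iff₀ hK]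
      simp only [NNReal.coe_one, one_mul]
      nlinarith [dist_nonneg (x := x) (y := y)]
    have h3 := h1 _ (by simp) hg
    rw [VectorMeasure.integral_fun_smul, VectorMeasure.integral_fun_sub
      (integrable_of_lipschitz μ hf) (integrable_const _), VectorMeasure.integral_const] at h3
    simpa [hm, hK.ne'] using h3
  set j := (μ : SignedMeasure Z).toJordanDecomposition with hj
  have hpn : j.posPart = j.negPart := by
    have huniv : j.posPart Set.univ = j.negPart Set.univ := by
      have h4 := h2 (fun _ => (1 : ℝ)) 0 (LipschitzWith.const 1)
      rw [integral_eq_jordan _ (integrable_const _)] at h4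
      simp only [integral_const, smul_eq_mul, mul_one] at h4
      have h5 := sub_eq_zero.1 h4
      exact (ENNReal.toReal_eq_toReal_iff' (measure_ne_top _ _) (measure_ne_top _ _)).1 h5
    refine ext_of_generate_finite _ (BorelSpace.measurable_eq.trans
      borel_eq_generateFrom_isClosed) isPiSystem_isClosed (fun F hF => ?_) huniv
    have hpos : ∀ n : ℕ, (0 : ℝ) < 1 / ((n : ℝ) + 1) := fun n => by positivity
    have hlim : Tendsto (fun n : ℕ => 1 / ((n : ℝ) + 1)) atTop (𝓝 0) :=
      tendsto_one_div_add_atTop_nhds_zero_nat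
    have hp := tendsto_integral_thickenedIndicator_of_isClosed j.posPart hF hpos hlim
    have hn := tendsto_integral_thickenedIndicator_of_isClosed j.negPart hF hpos hlim
    have heq : ∀ n : ℕ, ∫ ω, (thickenedIndicator (hpos n) F ω : ℝ) ∂j.posPart =
        ∫ ω, (thickenedIndicator (hpos n) F ω : ℝ) ∂j.negPart := by
      intro n
      have hL : LipschitzWith (1 * (1 / ((n : ℝ) + 1)).toNNReal⁻¹)
          fun ω => (thickenedIndicator (hpos n) F ω : ℝ) :=
        NNReal.isometry_coe.lipschitz.comp (lipschitzWith_thickenedIndicator (hpos n) F)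
      have h6 := h2 _ _ hL
      rw [integral_eq_jordan _ (integrable_of_lipschitz μ hL)] at h6
      exact sub_eq_zero.1 h6
    have h7 := tendsto_nhds_unique (hp.congr heq) hn
    exact (ENNReal.toReal_eq_toReal_iff' (measure_ne_top _ _) (measure_ne_top _ _)).1 h7
  have hz : (μ : SignedMeasure Z) = 0 := by
    rw [← SignedMeasure.toSignedMeasure_toJordanDecomposition (μ : SignedMeasure Z),
      JordanDecomposition.toSignedMeasure, ← hj]
    simp [hpn]
  exact Subtype.ext hz

theorem normCore (e : Z) : NormedSpace.Core ℝ (M1 e) where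
  norm_nonneg μ := add_nonneg (abs_nonneg _) (sSup_lipPairings_nonneg μ)
  norm_smul c μ := by
    refine le_antisymm (norm_smul_le_aux c μ) ?_
    rcases eq_or_ne c 0 with rfl | hc
    · rw [norm_zero, zero_mul]
      exact add_nonneg (abs_nonneg _) (sSup_lipPairings_nonneg ((0 : ℝ) • μ))
    · have h := norm_smul_le_aux c⁻¹ (c • μ)
      rw [inv_smul_smul₀ hc, abs_inv, ← div_eq_inv_mul, le_div_iff₀ (abs_pos.2 hc)] at h
      rw [Real.norm_eq_abs, mul_comm]
      exact h
  norm_triangle := norm_add_le_aux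
  norm_eq_zero_iff μ := by
    refine ⟨eq_zero_of_norm_eq_zero μ, ?_⟩
    rintro rfl
    have h := norm_smul_le_aux (0 : ℝ) (0 : M1 e)
    simp only [smul_zero, abs_zero, zero_mul] at h
    exact le_antisymm h (add_nonneg (abs_nonneg _) (sSup_lipPairings_nonneg (0 : M1 e)))

instance instNormedAddCommGroupM1 (e : Z) : NormedAddCommGroup (M1 e) :=
  NormedAddCommGroup.ofCore (normCore e)

instance instNormedSpaceM1 (e : Z) : NormedSpace ℝ (M1 e) :=
  NormedSpace.ofCore (normCore e)

/-- `KRu(Z)`: the completion of `𝓜₁(Z)` in the unbalanced Kantorovich-Rubinstein norm. -/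
abbrev KRu (e : Z) : Type _ := UniformSpace.Completion (M1 e)

/-- The regularizer `G_{α,β}` on `KRu(Z)`: if `μ` is (the image in the completion of) a measure
`ν ∈ 𝓜_p(Z)`, its value is `α ‖μ‖_KRu + β ∫ (1 + d(z, e)^p) d|ν|(z)`; otherwise it is `∞`.
There is at most one such `ν`, so the infimum is over at most one term, see `regularizer_coe` and
`regularizer_eq_top`. For `p ≥ 1` the inclusion `𝓜_p(Z) ⊆ 𝓜₁(Z)` is `momentMeasures_le_M1`. -/
def regularizer (e : Z) (p : ℝ) (α β : ℝ≥0) (μ : KRu e) : ℝ≥0∞ :=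
  ⨅ (ν : M1 e) (_ : (ν : SignedMeasure Z) ∈ momentMeasures e p ∧ (ν : KRu e) = μ),
    (α * ‖μ‖ₑ + β * ∫⁻ z, (1 + edist z e ^ p) ∂(ν : SignedMeasure Z).variation)

theorem regularizer_coe (e : Z) (p : ℝ) (α β : ℝ≥0) (ν : M1 e)
    (hν : (ν : SignedMeasure Z) ∈ momentMeasures e p) :
    regularizer e p α β (ν : KRu e) =
      α * ‖ν‖ₑ + β * ∫⁻ z, (1 + edist z e ^ p) ∂(ν : SignedMeasure Z).variation := by
  have hn : ‖(ν : KRu e)‖ₑ = ‖ν‖ₑ := by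
    rw [← ofReal_norm, ← ofReal_norm, UniformSpace.Completion.norm_coe]
  refine le_antisymm ((iInf₂_le ν ⟨hν, rfl⟩).trans_eq (by rw [hn])) (le_iInf₂ ?_)
  rintro ν' ⟨-, h⟩
  rw [UniformSpace.Completion.coe_injective _ h, hn]

theorem regularizer_eq_top (e : Z) (p : ℝ) (α β : ℝ≥0) (μ : KRu e)
    (h : ¬ ∃ ν : M1 e, (ν : SignedMeasure Z) ∈ momentMeasures e p ∧ (ν : KRu e) = μ) :
    regularizer e p α β μ = ∞ := by
  simp only [regularizer, iInf_eq_top]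
  exact fun ν hν => (h ⟨ν, hν⟩).elim

theorem momentMeasures_le_M1 (e : Z) {p : ℝ} (hp : 1 ≤ p) : momentMeasures e p ≤ M1 e := by
  intro μ hμ
  have h : ∫⁻ z, (1 + edist z e ^ p) ∂μ.variation < ∞ := by
    rw [lintegral_add_left measurable_const, lintegral_const]
    exact ENNReal.add_lt_top.2 ⟨ENNReal.mul_lt_top ENNReal.one_lt_top (measure_lt_top _ _), hμ⟩
  refine lt_of_le_of_lt (lintegral_mono fun z => ?_) h
  rcases le_total (edist z e) 1 with h1 | h1
  · exact le_add_right (by simpa using h1)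
  · exact le_add_left (ENNReal.rpow_le_rpow_of_exponent_le h1 hp)

end Measures

end KRSpace

/-- `F : H → (-∞, +∞]` is proper: it never takes the value `-∞` and is not identically `+∞`. -/
def IsProperFunctional {H : Type*} (F : H → EReal) : Prop :=
  (∀ x, F x ≠ ⊥) ∧ ∃ x, F x ≠ ⊤

/-- Convexity of an extended real valued functional. -/
def IsConvexFunctional {H : Type*} [AddCommGroup H] [Module ℝ H] (F : H → EReal) : Prop :=
  ∀ x y : H, ∀ a b : ℝ, 0 < a → 0 < b → a + b = 1 →
    F (a • x + b • y) ≤ (a : EReal) * F x + (b : EReal) * F y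

/-- Coercivity: `F x → +∞` as `‖x‖ → ∞`. -/
def IsCoerciveFunctional {H : Type*} [NormedAddCommGroup H] (F : H → EReal) : Prop :=
  Tendsto F (Bornology.cobounded H) (𝓝 ⊤)

end

/-!
The sublevel sets of the regularizer are shown to be compact; lower semicontinuity is then
immediate, because compact sets are closed, and minimizers come from the direct method.

By the Hopf-Rinow theorem (`IsGeodesicSpace.isCompact_closedBall`) closed balls of `Z` are compact,
so Prokhorov's theorem makes the set `K_c` of positive measures `σ` with
`∫ (1 + d(z, e)^p) dσ ≤ c` weakly compact (`isCompact_weightSublevel`). On `K_c` the weak topology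
is finer than the norm topology (`continuous_toM1`): since `p > 1`, the Arzelà-Ascoli theorem shows
that finitely many bounded continuous functions approximate all `f` with `f(e) = 0` and `L(f) ≤ 1`
up to a small multiple of `1 + d(z, e)^p` (`exists_finite_net_lipschitz`), so that the supremum in
the norm is controlled by finitely many integrals.

With `c = t / β`, the sublevel set at height `t` is the image under `(σ, τ) ↦ σ - τ` of
`{(σ, τ) ∈ K_c × K_c : α ‖σ - τ‖ + β ∫ (1 + d(z, e)^p) d(σ + τ) ≤ t}`. One inclusion is the Jordan
decomposition, the other holds because `|σ - τ| ≤ σ + τ`. The latter set is closed, since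
integration of a nonnegative continuous function is weakly lower semicontinuous. Hence its image is
compact (`isCompact_setOf_regularizer_le`), and neither the limit measures nor the bound on them
need a separate argument.

For the direct method, a proper, convex, coercive and lower semicontinuous `F` is bounded below
(`IsConvexFunctional.exists_forall_coe_le`), so that only a sublevel set of the regularizer matters.
-/

/-! ### Closed balls of complete locally compact geodesic spaces -/

section HopfRinow

variable {Z : Type*} [MetricSpace Z]

theorem IsGeodesicSpace.closedBall_add_subset_cthickening (hZ : IsGeodesicSpace Z) (e : Z)
    {r δ : ℝ} (hr : 0 ≤ r) (hδ : 0 ≤ δ) :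
    Metric.closedBall e (r + δ) ⊆ Metric.cthickening δ (Metric.closedBall e r) := by
  intro x hx
  rw [Metric.mem_closedBall, dist_comm] at hx
  obtain ⟨γ, h0, h1, hγ⟩ := hZ e x
  have hm : min r (dist e x) ∈ Set.Icc 0 (dist e x) := ⟨le_min hr dist_nonneg, min_le_right _ _⟩
  refine Metric.mem_cthickening_of_dist_le x (γ (min r (dist e x))) δ _ ?_ ?_
  · have h := hγ _ hm 0 ⟨le_rfl, dist_nonneg⟩
    rw [h0, sub_zero, abs_of_nonneg hm.1] at h
    rw [Metric.mem_closedBall, h]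
    exact min_le_left _ _
  · have h := hγ _ ⟨dist_nonneg, le_rfl⟩ _ hm
    rw [h1, abs_of_nonneg (sub_nonneg.2 hm.2)] at h
    rw [h]
    rcases le_total r (dist e x) with h | h
    · rw [min_eq_left h]; linarith
    · rw [min_eq_right h]; linarith

/-- The Hopf-Rinow theorem. The supremum `R` of the radii of compact balls around `e` would, if
finite, be attained (the ball of radius `R` is totally bounded), and could then be increased by
local compactness. -/
theorem IsGeodesicSpace.isCompact_closedBall [CompleteSpace Z] [LocallyCompactSpace Z]
    (hZ : IsGeodesicSpace Z) (e : Z) (r : ℝ) : IsCompact (Metric.closedBall e r) := by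
  by_contra hr
  set S : Set ℝ := {s | IsCompact (Metric.closedBall e s)} with hS
  have hmono : ∀ s ∈ S, ∀ t ≤ s, t ∈ S := fun s hs t hts =>
    hs.of_isClosed_subset Metric.isClosed_closedBall (Metric.closedBall_subset_closedBall hts)
  have hbdd : BddAbove S := ⟨r, fun s hs => le_of_not_gt fun h => hr (hmono s hs r h.le)⟩
  have h0 : (0 : ℝ) ∈ S := by simp [hS]
  set R := sSup S
  have hR0 : 0 ≤ R := le_csSup hbdd h0
  have hlt : ∀ s < R, s ∈ S := fun s hs => by
    obtain ⟨t, ht, hst⟩ := exists_lt_of_lt_csSup ⟨0, h0⟩ hs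
    exact hmono t ht s hst.le
  have hR : R ∈ S := by
    refine TotallyBounded.isCompact_of_isClosed ?_ Metric.isClosed_closedBall
    rw [Metric.totallyBounded_iff]
    intro ε hε
    -- an `ε/2`-net of the compact ball of radius `max 0 (R - ε/4)` is an `ε`-net of the ball of
    -- radius `R`
    have hsub : Metric.closedBall e R ⊆
        Metric.cthickening (ε / 4) (Metric.closedBall e (max 0 (R - ε / 4))) := by
      refine subset_trans (Metric.closedBall_subset_closedBall ?_)
        (hZ.closedBall_add_subset_cthickening e (le_max_left _ _) (by positivity))
      linarith [le_max_right 0 (R - ε / 4)]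
    have hc : IsCompact (Metric.closedBall e (max 0 (R - ε / 4))) := by
      rcases le_total 0 (R - ε / 4) with h | h
      · rw [max_eq_right h]; exact hlt _ (by linarith)
      · rw [max_eq_left h]; exact h0
    obtain ⟨t, ht, hcov⟩ := Metric.totallyBounded_iff.1 hc.totallyBounded (ε / 2) (by positivity)
    refine ⟨t, ht, fun x hx => ?_⟩
    have hx' := hsub hx
    rw [hc.cthickening_eq_biUnion_closedBall (by positivity)] at hx'
    simp only [Set.mem_iUnion, exists_prop] at hx'
    obtain ⟨y, hy, hxy⟩ := hx'
    have hy' := hcov hy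
    simp only [Set.mem_iUnion, exists_prop] at hy' ⊢
    obtain ⟨z, hz, hyz⟩ := hy'
    refine ⟨z, hz, ?_⟩
    rw [Metric.mem_ball] at hyz ⊢
    rw [Metric.mem_closedBall] at hxy
    linarith [dist_triangle x y z]
  obtain ⟨δ, hδ, hc⟩ := IsCompact.exists_isCompact_cthickening hR
  have : R + δ ∈ S := hc.of_isClosed_subset Metric.isClosed_closedBall
    (hZ.closedBall_add_subset_cthickening e hR0 hδ.le)
  linarith [le_csSup hbdd this]

end HopfRinow

/-! ### The direct method -/

section DirectMethod

/-- By lower semicontinuity `F` is bounded below on a ball around a point `x₀` where it is finite;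
along segments issuing from `x₀` convexity extends this to all bounded sets, and coercivity covers
the complement of a large ball. -/
theorem IsConvexFunctional.exists_forall_coe_le {H : Type*} [NormedAddCommGroup H]
    [NormedSpace ℝ H] {F : H → EReal} (hprop : IsProperFunctional F) (hconv : IsConvexFunctional F)
    (hcoer : IsCoerciveFunctional F) (hlsc : LowerSemicontinuous F) :
    ∃ m : ℝ, ∀ x, (m : EReal) ≤ F x := by
  obtain ⟨hbot, x₀, hx₀⟩ := hprop
  obtain ⟨a, ha⟩ : ∃ a : ℝ, F x₀ = a := ⟨_, (EReal.coe_toReal hx₀ (hbot x₀)).symm⟩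
  have h1 : ((a - 1 : ℝ) : EReal) < F x₀ := by
    rw [ha]; exact_mod_cast sub_one_lt a
  obtain ⟨δ, hδ, hball⟩ := Metric.eventually_nhds_iff.1 (hlsc x₀ _ h1)
  have h2 : ∀ᶠ x in Bornology.cobounded H, (0 : EReal) < F x :=
    hcoer.eventually (lt_mem_nhds EReal.zero_lt_top)
  obtain ⟨R, -, hR⟩ := (Metric.hasBasis_cobounded_compl_closedBall (0 : H)).eventually_iff.1 h2
  -- `s` is so small that `x₀ + s (x - x₀)` stays in the `δ`-ball around `x₀` when `‖x‖ ≤ R`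
  set s : ℝ := δ / (δ + |R| + ‖x₀‖ + 1) with hs
  have hden : 0 < δ + |R| + ‖x₀‖ + 1 := by positivity
  have hs0 : 0 < s := by positivity
  have hs1 : s < 1 := by
    rw [hs, div_lt_one hden]; linarith [abs_nonneg R, norm_nonneg x₀]
  refine ⟨min 0 (a - 1 / s), fun x => ?_⟩
  by_cases hx : ‖x‖ ≤ R
  · have hy := hball (y := (1 - s) • x₀ + s • x) (by
      have he : (1 - s) • x₀ + s • x - x₀ = s • (x - x₀) := by module
      rw [dist_eq_norm, he, norm_smul, Real.norm_of_nonneg hs0.le, hs, div_mul_eq_mul_div,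
        div_lt_iff₀ hden]
      have : ‖x - x₀‖ < δ + |R| + ‖x₀‖ + 1 := by
        linarith [norm_sub_le x x₀, le_abs_self R]
      exact mul_lt_mul_of_pos_left this hδ)
    have hc := hy.le.trans (hconv x₀ x (1 - s) s (by linarith) hs0 (by ring))
    rcases eq_or_ne (F x) ⊤ with hT | hT
    · rw [hT]; exact le_top
    obtain ⟨b, hb⟩ : ∃ b : ℝ, F x = b := ⟨_, (EReal.coe_toReal hT (hbot x)).symm⟩
    rw [ha, hb] at hc
    have hc' : a - 1 ≤ (1 - s) * a + s * b := by exact_mod_cast hc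
    rw [hb, EReal.coe_le_coe_iff]
    refine (min_le_right _ _).trans ?_
    have h3 : s * (a - 1 / s) ≤ s * b := by
      rw [mul_sub, mul_one_div_cancel hs0.ne']; linarith
    exact le_of_mul_le_mul_left h3 hs0
  · refine le_trans ?_ (hR (by simpa using hx)).le
    exact_mod_cast min_le_left _ _

theorem exists_forall_add_le_of_isCompact_sublevel {X : Type*} [TopologicalSpace X] [Nonempty X]
    {f : X → EReal} {g : X → ℝ≥0∞} {m : ℝ} (hm : ∀ x, (m : EReal) ≤ f x)
    (hf : LowerSemicontinuous f) (hg : LowerSemicontinuous g)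
    (hc : ∀ t : ℝ≥0, IsCompact {x | g x ≤ t}) :
    ∃ x₀, ∀ x, f x₀ + (g x₀ : EReal) ≤ f x + (g x : EReal) := by
  by_cases htop : ∀ x, f x + (g x : EReal) = ⊤
  · obtain ⟨x₀⟩ := ‹Nonempty X›
    exact ⟨x₀, fun x => by rw [htop x]; exact le_top⟩
  push Not at htop
  obtain ⟨x₁, hx₁⟩ := htop
  have hbot : ∀ x, f x ≠ ⊥ := fun x h => by simpa [h] using hm x
  have hg0 : ∀ x, (g x : EReal) ≠ ⊥ := fun x => EReal.coe_ennreal_ne_bot _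
  have hlsc : LowerSemicontinuous fun x => f x + (g x : EReal) := by
    refine hf.add' (continuous_coe_ennreal_ereal.comp_lowerSemicontinuous hg
      (fun _ _ h => EReal.coe_ennreal_le_coe_ennreal_iff.2 h)) fun x => ?_
    exact EReal.continuousAt_add (Or.inr (hg0 x)) (Or.inl (hbot x))
  obtain ⟨v, hv⟩ : ∃ v : ℝ, f x₁ + (g x₁ : EReal) = v :=
    ⟨_, (EReal.coe_toReal hx₁ (by simp [EReal.add_eq_bot_iff, hbot, hg0])).symm⟩
  -- outside the sublevel set at height `v - m` the sum exceeds its value `v` at `x₁`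
  have key : ∀ x, g x ≤ (v - m).toNNReal ∨ (v : EReal) ≤ f x + (g x : EReal) := by
    intro x
    refine or_iff_not_imp_left.2 fun h => ?_
    have h1 : (((v - m).toNNReal : ℝ≥0∞) : EReal) ≤ (g x : EReal) :=
      EReal.coe_ennreal_le_coe_ennreal_iff.2 (not_le.1 h).le
    have h2 : ((v - m : ℝ) : EReal) ≤ (g x : EReal) := by
      refine le_trans ?_ h1
      rw [EReal.coe_nnreal_eq_coe_real]
      exact_mod_cast Real.le_coe_toNNReal _
    calc (v : EReal) = (m : EReal) + ((v - m : ℝ) : EReal) := by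
          rw [← EReal.coe_add]; congr 1; ring
      _ ≤ _ := add_le_add (hm x) h2
  by_cases hmin₁ : ∀ x, (v : EReal) ≤ f x + (g x : EReal)
  · exact ⟨x₁, fun x => hv.trans_le (hmin₁ x)⟩
  push Not at hmin₁
  obtain ⟨x₂, hx₂⟩ := hmin₁
  have hx₂K := (key x₂).resolve_right hx₂.not_ge
  obtain ⟨x₀, -, hmin⟩ := (hlsc.lowerSemicontinuousOn _).exists_isMinOn ⟨x₂, hx₂K⟩ (hc _)
  exact ⟨x₀, fun x =>
    (key x).elim (fun hx => hmin hx) fun hx => (hmin hx₂K).trans (hx₂.le.trans hx)⟩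

end DirectMethod

namespace KRSpace

/-! ### Positive measures with a bounded weighted moment -/

section Weight

variable {Z : Type*} [MetricSpace Z]

/-- The weight `1 + d(z, e)^p` that defines `regularizer`. -/
noncomputable def weight (e : Z) (p : ℝ) (z : Z) : ℝ≥0 := 1 + nndist z e ^ p

theorem coe_weight (e : Z) {p : ℝ} (hp : 0 ≤ p) (z : Z) :
    (weight e p z : ℝ≥0∞) = 1 + edist z e ^ p := by
  rw [weight, ENNReal.coe_add, ENNReal.coe_rpow_of_nonneg _ hp, edist_nndist, ENNReal.coe_one]

theorem coe_weight_real (e : Z) (p : ℝ) (z : Z) : (weight e p z : ℝ) = 1 + dist z e ^ p := by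
  simp [weight]

theorem continuous_weight (e : Z) {p : ℝ} (hp : 0 ≤ p) : Continuous (weight e p) :=
  continuous_const.add
    ((NNReal.continuous_rpow_const hp).comp (continuous_id.nndist continuous_const))

theorem nat_le_weight (e : Z) {p : ℝ} (hp : 1 ≤ p) (n : ℕ) {z : Z}
    (hz : z ∉ Metric.closedBall e n) : (n : ℝ≥0) + 1 ≤ weight e p z := by
  rw [Metric.mem_closedBall, not_le] at hz
  rw [← NNReal.coe_le_coe, coe_weight_real]
  push_cast
  rcases Nat.eq_zero_or_pos n with rfl | hn
  · simpa using Real.rpow_nonneg dist_nonneg p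
  have h1 : (1 : ℝ) ≤ dist z e := le_trans (by exact_mod_cast hn) hz.le
  linarith [Real.self_le_rpow_of_one_le h1 hp]

variable [MeasurableSpace Z]

/-- The finite positive measures `σ` with `∫ (1 + d(z, e)^p) dσ(z) ≤ c`. -/
def weightSublevel (e : Z) (p : ℝ) (c : ℝ≥0) : Set (FiniteMeasure Z) :=
  {σ | ∫⁻ z, weight e p z ∂(σ : Measure Z) ≤ c}

variable [BorelSpace Z]

/-- A supremum of the weakly continuous functionals `σ ↦ ∫ min(w, n) dσ`. -/
theorem lowerSemicontinuous_lintegral_nnreal {w : Z → ℝ≥0} (hw : Continuous w) :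
    LowerSemicontinuous fun σ : FiniteMeasure Z => ∫⁻ z, w z ∂(σ : Measure Z) := by
  let g : ℕ → BoundedContinuousFunction Z ℝ≥0 := fun n =>
    BoundedContinuousFunction.mkOfBound ⟨fun z => min (w z) n, hw.min continuous_const⟩ n
      fun x y => by
        have h1 : (min (w x) n : ℝ≥0) ≤ n := min_le_right _ _
        have h2 : (min (w y) n : ℝ≥0) ≤ n := min_le_right _ _
        rw [NNReal.dist_eq, abs_le]
        have h1' : ((min (w x) n : ℝ≥0) : ℝ) ≤ n := by exact_mod_cast h1
        have h2' : ((min (w y) n : ℝ≥0) : ℝ) ≤ n := by exact_mod_cast h2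
        have h3 := (min (w x) n : ℝ≥0).coe_nonneg
        have h4 := (min (w y) n : ℝ≥0).coe_nonneg
        constructor <;> simp only [ContinuousMap.coe_mk] <;> linarith
  have hsup : ∀ σ : FiniteMeasure Z, ∫⁻ z, w z ∂(σ : Measure Z) =
      ⨆ n, ((σ.testAgainstNN (g n) : ℝ≥0) : ℝ≥0∞) := by
    intro σ
    simp_rw [FiniteMeasure.testAgainstNN_coe_eq]
    rw [← lintegral_iSup]
    · refine lintegral_congr fun z => le_antisymm ?_ (iSup_le fun n => ?_)
      · obtain ⟨n, hn⟩ := exists_nat_ge (w z)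
        refine le_iSup_of_le n ?_
        have : g n z = w z := min_eq_left hn
        rw [this]
      · exact_mod_cast min_le_left (w z) (n : ℝ≥0)
    · exact fun n => ((g n).continuous.measurable).coe_nnreal_ennreal
    · intro n m hnm z
      have : g n z ≤ g m z := min_le_min le_rfl (by exact_mod_cast hnm)
      exact ENNReal.coe_le_coe.2 this
  simp_rw [hsup]
  exact lowerSemicontinuous_iSup fun n => (ENNReal.continuous_coe.comp
    (FiniteMeasure.continuous_testAgainstNN_eval (g n))).lowerSemicontinuous

/-- Prokhorov's theorem applies by Markov's inequality: the mass outside the closed ball of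
radius `n` is at most `c / (n + 1)`. -/
theorem isCompact_weightSublevel {e : Z} (hK : ∀ r, IsCompact (Metric.closedBall e r)) {p : ℝ}
    (hp : 1 ≤ p) (c : ℝ≥0) : IsCompact (weightSublevel e p c) := by
  have hu : Tendsto (fun n : ℕ => c / ((n : ℝ≥0) + 1)) atTop (𝓝 0) := by
    have h := tendsto_const_div_atTop_nhds_zero_nat (c : ℝ)
    have h' := (tendsto_add_atTop_iff_nat 1).2 h
    rw [← NNReal.tendsto_coe]
    simpa using h'
  refine (isCompact_setOfPred_finiteMeasure_mass_le_compl_isCompact_le c hu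
    (fun n : ℕ => hK n) (Or.inl inferInstance)).of_isClosed_subset ?_ ?_
  · exact (lowerSemicontinuous_lintegral_nnreal
      (continuous_weight e (zero_le_one.trans hp))).isClosed_preimage (c : ℝ≥0∞)
  · intro σ hσ
    have hσ' : ∫⁻ z, weight e p z ∂(σ : Measure Z) ≤ c := hσ
    refine ⟨?_, fun n => ?_⟩
    · rw [← ENNReal.coe_le_coe, FiniteMeasure.ennreal_mass]
      refine le_trans ?_ hσ'
      rw [← lintegral_one]
      refine lintegral_mono fun z => ?_
      rw [coe_weight e (zero_le_one.trans hp)]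
      exact le_self_add
    · rw [le_div_iff₀ (by positivity), ← ENNReal.coe_le_coe, ENNReal.coe_mul,
        FiniteMeasure.ennreal_coeFn_eq_coeFn_toMeasure, mul_comm]
      refine le_trans ?_ ((mul_meas_ge_le_lintegral
        (continuous_weight e (zero_le_one.trans hp)).measurable.coe_nnreal_ennreal
        (((n : ℝ≥0) + 1 : ℝ≥0) : ℝ≥0∞)).trans hσ')
      gcongr
      intro z hz
      exact ENNReal.coe_le_coe.2 (nat_le_weight e hp n hz)

end Weight

/-! ### Uniform approximation of Lipschitz functions -/

section Net

variable {Z : Type*} [MetricSpace Z]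

/-- Outside a large ball `2 d(·, e)` is below `δ` times the weight, which is where `p > 1` enters.
On that ball the normalized Lipschitz functions are totally bounded by the Arzelà-Ascoli theorem;
clamping the members of a finite net makes them bounded. -/
theorem exists_finite_net_lipschitz {e : Z} (hK : ∀ r, IsCompact (Metric.closedBall e r)) {p : ℝ}
    (hp : 1 < p) {δ : ℝ} (hδ : 0 < δ) :
    ∃ T : Set (BoundedContinuousFunction Z ℝ), T.Finite ∧
      ∀ f : Z → ℝ, f e = 0 → LipschitzWith 1 f → ∃ h ∈ T, ∀ z, |f z - h z| ≤ δ * weight e p z := by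
  obtain ⟨R₀, hR₀⟩ := (((tendsto_rpow_atTop (sub_pos.2 hp)).eventually
    (eventually_ge_atTop (2 / δ)))).exists_forall_of_atTop
  set R := max R₀ 1
  have hfar : ∀ d : ℝ, R < d → 2 * d ≤ δ * d ^ p := by
    intro d hd
    have hd0 : 0 < d := lt_of_lt_of_le one_pos ((le_max_right R₀ 1).trans hd.le)
    have h := hR₀ d ((le_max_left R₀ 1).trans hd.le)
    rw [div_le_iff₀ hδ] at h
    have h2 : d ^ p = d ^ (p - 1) * d := by
      rw [← Real.rpow_add_one hd0.ne']; congr 1; ring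
    rw [h2]
    nlinarith
  have hR0 : 0 ≤ R := zero_le_one.trans (le_max_right _ _)
  set K := Metric.closedBall e R
  have : CompactSpace K := isCompact_iff_compactSpace.1 (hK R)
  let A : Set (BoundedContinuousFunction K ℝ) :=
    {g | ∃ f : Z → ℝ, f e = 0 ∧ LipschitzWith 1 f ∧ ∀ z : K, g z = f z}
  have hfd : ∀ f : Z → ℝ, f e = 0 → LipschitzWith 1 f → ∀ z, |f z| ≤ dist z e := by
    intro f hfe hf z
    simpa [hfe, Real.dist_eq] using hf.dist_le_mul z e
  have hA : TotallyBounded A := by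
    refine TotallyBounded.subset subset_closure (IsCompact.totallyBounded ?_)
    refine BoundedContinuousFunction.arzela_ascoli (Set.Icc (-R) R) isCompact_Icc A ?_ ?_
    · rintro g z ⟨f, hfe, hf, hg⟩
      rw [hg z]
      exact abs_le.1 ((hfd f hfe hf z).trans z.2)
    · refine (LipschitzWith.uniformEquicontinuous _ 1 fun g => ?_).equicontinuous
      obtain ⟨g, f, hfe, hf, hg⟩ := g
      refine LipschitzWith.of_dist_le_mul fun x y => ?_
      simp only [hg]
      exact hf.dist_le_mul x y
  -- clamping to `[-R, R]` changes nothing on the ball and keeps the bound by `d(·, e)` outside it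
  have hext : ∀ g ∈ A, ∃ h : BoundedContinuousFunction Z ℝ,
      (∀ z : K, h z = g z) ∧ ∀ z, |h z| ≤ dist z e := by
    rintro g ⟨f, hfe, hf, hg⟩
    refine ⟨BoundedContinuousFunction.ofNormedAddCommGroup (fun z => max (-R) (min R (f z)))
      (continuous_const.max (continuous_const.min hf.continuous)) R fun z => ?_, fun z => ?_,
      fun z => ?_⟩
    · exact abs_le.2 ⟨le_max_left _ _, max_le (by linarith) (min_le_left _ _)⟩
    · have h := abs_le.1 ((hfd f hfe hf z).trans z.2)
      simp [hg, h.1, h.2]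
    · have h := abs_le.1 (hfd f hfe hf z)
      exact abs_le.2 ⟨le_max_of_le_right (le_min (by linarith [dist_nonneg (x := z) (y := e)]) h.1),
        max_le (by linarith [dist_nonneg (x := z) (y := e)]) ((min_le_right _ _).trans h.2)⟩
  choose! H hHK hHd using hext
  obtain ⟨t, htA, htf, hcov⟩ := Metric.finite_approx_of_totallyBounded hA δ hδ
  refine ⟨H '' t, htf.image H, fun f hfe hf => ?_⟩
  let g : BoundedContinuousFunction K ℝ := BoundedContinuousFunction.mkOfCompact
    ⟨fun z : K => f z, hf.continuous.comp continuous_subtype_val⟩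
  have hg := hcov (show g ∈ A from ⟨f, hfe, hf, fun z => rfl⟩)
  simp only [Set.mem_iUnion, exists_prop] at hg
  obtain ⟨g', hg't, hgg'⟩ := hg
  refine ⟨H g', Set.mem_image_of_mem H hg't, fun z => ?_⟩
  rw [coe_weight_real, mul_add, mul_one]
  have hdp : 0 ≤ δ * dist z e ^ p := by positivity
  rcases le_or_gt (dist z e) R with hz | hz
  · have h1 : dist (g ⟨z, hz⟩) (g' ⟨z, hz⟩) < δ :=
      (BoundedContinuousFunction.dist_coe_le_dist _).trans_lt hgg'
    rw [← hHK g' (htA hg't) ⟨z, hz⟩, Real.dist_eq] at h1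
    exact (h1.le : |f z - H g' z| ≤ δ).trans (by linarith)
  · linarith [abs_sub (f z) (H g' z), hfd f hfe hf z, hHd g' (htA hg't) z, hfar _ hz]

end Net
/-! ### Compactness of the sublevel sets of the regularizer -/

section Compactness

variable {Z : Type*} [MetricSpace Z] [MeasurableSpace Z] {e : Z} {p : ℝ} {c : ℝ≥0}

theorem integral_weight_le {σ : FiniteMeasure Z} (hσ : σ ∈ weightSublevel e p c) :
    ∫ z, (weight e p z : ℝ) ∂(σ : Measure Z) ≤ c :=
  integral_coe_le_of_lintegral_coe_le hσ

theorem toSignedMeasure_mem_momentMeasures (hp : 0 ≤ p) {σ : FiniteMeasure Z}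
    (hσ : σ ∈ weightSublevel e p c) :
    (σ : Measure Z).toSignedMeasure ∈ momentMeasures e p := by
  have h : ∫⁻ z, weight e p z ∂(σ : Measure Z) ≤ c := hσ
  change ∫⁻ z, edist z e ^ p ∂(σ : Measure Z).toSignedMeasure.variation < ∞
  rw [Measure.variation_toSignedMeasure]
  refine (lintegral_mono fun z => ?_).trans_lt (h.trans_lt ENNReal.coe_lt_top)
  rw [coe_weight e hp]
  exact le_add_self

variable [BorelSpace Z]

theorem integrable_weight (hp : 0 ≤ p) {σ : FiniteMeasure Z} (hσ : σ ∈ weightSublevel e p c) :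
    Integrable (fun z => (weight e p z : ℝ)) (σ : Measure Z) := by
  refine ⟨(NNReal.continuous_coe.comp (continuous_weight e hp)).aestronglyMeasurable, ?_⟩
  have h : ∫⁻ z, weight e p z ∂(σ : Measure Z) ≤ c := hσ
  simpa [HasFiniteIntegral] using h.trans_lt ENNReal.coe_lt_top

theorem abs_integral_sub_integral_le (hp : 0 ≤ p) {σ : FiniteMeasure Z}
    (hσ : σ ∈ weightSublevel e p c) {f h : Z → ℝ} (hf : Integrable f (σ : Measure Z))
    (hh : Integrable h (σ : Measure Z)) {δ : ℝ} (hδ : 0 ≤ δ)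
    (hfh : ∀ z, |f z - h z| ≤ δ * weight e p z) :
    |∫ z, f z ∂(σ : Measure Z) - ∫ z, h z ∂(σ : Measure Z)| ≤ δ * c := by
  rw [← integral_sub hf hh]
  refine (abs_integral_le_integral_abs).trans ((integral_mono (hf.sub hh).abs
    ((integrable_weight hp hσ).const_mul δ) hfh).trans ?_)
  rw [integral_const_mul]
  exact mul_le_mul_of_nonneg_left (integral_weight_le hσ) hδ

/-- A positive measure with bounded weighted moment as an element of `𝓜₁(Z)`. -/
noncomputable def toM1 (hp : 1 ≤ p) (σ : weightSublevel e p c) : M1 e :=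
  ⟨(σ.1 : Measure Z).toSignedMeasure, momentMeasures_le_M1 e hp
    (toSignedMeasure_mem_momentMeasures (zero_le_one.trans hp) σ.2)⟩

theorem integrable_of_lipschitz_weightSublevel (hp : 1 ≤ p) (σ : weightSublevel e p c) {f : Z → ℝ}
    (hf : LipschitzWith 1 f) : Integrable f (σ.1 : Measure Z) := by
  have h := integrable_of_lipschitz (toM1 hp σ) hf
  simpa [VectorMeasure.Integrable, toM1] using h

theorem norm_toM1_sub_le (hp : 1 ≤ p) (σ τ : weightSublevel e p c) {r : ℝ}
    (h : ∀ f : Z → ℝ, f e = 0 → LipschitzWith 1 f →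
      ∫ z, f z ∂(σ.1 : Measure Z) - ∫ z, f z ∂(τ.1 : Measure Z) ≤ r) :
    ‖toM1 hp σ - toM1 hp τ‖ ≤ |(σ.1.mass : ℝ) - τ.1.mass| + r := by
  rw [norm_def]
  refine add_le_add (le_of_eq ?_) (csSup_le (lipPairings_nonempty e _) ?_)
  · simp only [toM1, Submodule.coe_sub, sub_apply,
      Measure.toSignedMeasure_apply_measurable MeasurableSet.univ]
    rfl
  · rintro _ ⟨f, hfe, hf, rfl⟩
    rw [Submodule.coe_sub, VectorMeasure.integral_sub_vectorMeasure
      (integrable_of_lipschitz _ hf) (integrable_of_lipschitz _ hf)]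
    simp only [toM1, VectorMeasure.integral_toSignedMeasure]
    exact h f hfe hf

/-- On measures with bounded weighted moment, weak convergence implies convergence in the
Kantorovich-Rubinstein norm: up to a uniformly small error the supremum in the norm only involves
finitely many bounded continuous functions. -/
theorem continuous_toM1 (hK : ∀ r, IsCompact (Metric.closedBall e r)) (hp : 1 < p) :
    Continuous (toM1 hp.le : weightSublevel e p c → M1 e) := by
  refine continuous_iff_continuousAt.2 fun τ => Metric.tendsto_nhds.2 fun ε hε => ?_
  -- `σ` and `τ` each contribute an approximation error of at most `δ * c`
  set δ := ε / (4 * (c + 1)) with hδdef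
  have hδ : 0 < δ := by positivity
  have hδc : δ * c < ε / 4 := by
    rw [hδdef, div_mul_eq_mul_div, div_lt_div_iff₀ (by positivity) (by positivity)]
    nlinarith
  obtain ⟨T, hT, hnet⟩ := exists_finite_net_lipschitz hK hp hδ
  have h1 : ∀ᶠ σ : weightSublevel e p c in 𝓝 τ, ∀ h ∈ T,
      |∫ z, h z ∂(σ.1 : Measure Z) - ∫ z, h z ∂(τ.1 : Measure Z)| < ε / 4 := by
    refine (Filter.eventually_all_finite hT).2 fun h _ => ?_
    exact Metric.tendsto_nhds.1 (((FiniteMeasure.continuous_integral_boundedContinuousFunction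
      h).comp continuous_subtype_val).tendsto τ) _ (by positivity)
  have h2 : ∀ᶠ σ : weightSublevel e p c in 𝓝 τ, |(σ.1.mass : ℝ) - τ.1.mass| < ε / 4 :=
    Metric.tendsto_nhds.1 ((NNReal.continuous_coe.comp
      (FiniteMeasure.continuous_mass.comp continuous_subtype_val)).tendsto τ) _ (by positivity)
  filter_upwards [h1, h2] with σ hσ1 hσ2
  rw [dist_eq_norm]
  refine (norm_toM1_sub_le hp.le σ τ (r := 2 * (δ * c) + ε / 4) fun f hfe hf => ?_).trans_lt
    (by linarith)
  obtain ⟨h, hhT, hh⟩ := hnet f hfe hf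
  have hp0 : 0 ≤ p := zero_le_one.trans hp.le
  have a1 := abs_le.1 (abs_integral_sub_integral_le hp0 σ.2
    (integrable_of_lipschitz_weightSublevel hp.le σ hf) (h.integrable _) hδ.le hh)
  have a2 := abs_le.1 (abs_integral_sub_integral_le hp0 τ.2
    (integrable_of_lipschitz_weightSublevel hp.le τ hf) (h.integrable _) hδ.le hh)
  have a3 := abs_lt.1 (hσ1 h hhT)
  linarith

theorem regularizer_toM1_sub_le (hp : 1 ≤ p) (α β : ℝ≥0) (σ τ : weightSublevel e p c) :
    regularizer e p α β ((toM1 hp σ - toM1 hp τ : M1 e) : KRu e) ≤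
      α * ‖toM1 hp σ - toM1 hp τ‖ₑ + β * (∫⁻ z, weight e p z ∂(σ.1 : Measure Z) +
        ∫⁻ z, weight e p z ∂(τ.1 : Measure Z)) := by
  have hp0 : 0 ≤ p := zero_le_one.trans hp
  rw [regularizer_coe]
  · gcongr
    rw [← lintegral_add_measure]
    simp_rw [← coe_weight e hp0]
    refine lintegral_mono' ?_ le_rfl
    refine VectorMeasure.variation_sub_le.trans_eq ?_
    simp [toM1]
  · exact Submodule.sub_mem _ (toSignedMeasure_mem_momentMeasures hp0 σ.2)
      (toSignedMeasure_mem_momentMeasures hp0 τ.2)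

/-- The witnesses are the positive and negative parts of the Jordan decomposition, for which
`regularizer_toM1_sub_le` is an equality. -/
theorem exists_toM1_sub_eq_of_regularizer_le (hp : 1 ≤ p) (α : ℝ≥0)
    {β : ℝ≥0} (hβ : 0 < β) {t : ℝ≥0} {μ : KRu e}
    (hμ : regularizer e p α β μ ≤ t) :
    ∃ σ τ : weightSublevel e p (t / β), ((toM1 hp σ - toM1 hp τ : M1 e) : KRu e) = μ ∧
      α * ‖toM1 hp σ - toM1 hp τ‖ₑ + β * (∫⁻ z, weight e p z ∂(σ.1 : Measure Z) +
        ∫⁻ z, weight e p z ∂(τ.1 : Measure Z)) ≤ t := by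
  have hp0 : 0 ≤ p := zero_le_one.trans hp
  obtain ⟨ν, hν, rfl⟩ :
      ∃ ν : M1 e, (ν : SignedMeasure Z) ∈ momentMeasures e p ∧ (ν : KRu e) = μ := by
    by_contra h
    rw [regularizer_eq_top e p α β μ h] at hμ
    exact ENNReal.coe_ne_top (top_le_iff.1 hμ)
  rw [regularizer_coe e p α β ν hν] at hμ
  set j := (ν : SignedMeasure Z).toJordanDecomposition
  have hvar : (ν : SignedMeasure Z).variation = j.posPart + j.negPart := by
    rw [← SignedMeasure.totalVariation_eq_variation]; rfl
  simp_rw [hvar, ← coe_weight e hp0, lintegral_add_measure] at hμ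
  have hc : ∫⁻ z, weight e p z ∂j.posPart + ∫⁻ z, weight e p z ∂j.negPart ≤ (t / β : ℝ≥0) := by
    rw [ENNReal.coe_div hβ.ne', ENNReal.le_div_iff_mul_le (by simp [hβ.ne']) (by simp), mul_comm]
    exact le_add_self.trans hμ
  let σ : weightSublevel e p (t / β) := ⟨⟨j.posPart, inferInstance⟩, le_self_add.trans hc⟩
  let τ : weightSublevel e p (t / β) := ⟨⟨j.negPart, inferInstance⟩, le_add_self.trans hc⟩
  have hστ : toM1 hp σ - toM1 hp τ = ν :=
    Subtype.ext (SignedMeasure.toSignedMeasure_toJordanDecomposition (ν : SignedMeasure Z))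
  exact ⟨σ, τ, by rw [hστ], by rw [hστ]; exact hμ⟩

/-- The sublevel set is the continuous image of a closed set of pairs of positive measures. -/
theorem isCompact_setOf_regularizer_le (hK : ∀ r, IsCompact (Metric.closedBall e r)) (hp : 1 < p)
    (α : ℝ≥0) {β : ℝ≥0} (hβ : 0 < β) (t : ℝ≥0) :
    IsCompact {μ : KRu e | regularizer e p α β μ ≤ t} := by
  have : CompactSpace (weightSublevel e p (t / β)) :=
    isCompact_iff_compactSpace.1 (isCompact_weightSublevel hK hp.le _)
  have hφ : Continuous fun x : weightSublevel e p (t / β) × weightSublevel e p (t / β) =>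
      toM1 hp.le x.1 - toM1 hp.le x.2 :=
    ((continuous_toM1 hK hp).comp continuous_fst).sub ((continuous_toM1 hK hp).comp continuous_snd)
  have hw := lowerSemicontinuous_lintegral_nnreal (continuous_weight e (zero_le_one.trans hp.le))
  have hlsc : LowerSemicontinuous
      fun x : weightSublevel e p (t / β) × weightSublevel e p (t / β) =>
        α * ‖toM1 hp.le x.1 - toM1 hp.le x.2‖ₑ +
          β * (∫⁻ z, weight e p z ∂(x.1.1 : Measure Z) +
            ∫⁻ z, weight e p z ∂(x.2.1 : Measure Z)) := by
    refine LowerSemicontinuous.add ?_ ?_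
    · exact ((ENNReal.continuous_const_mul ENNReal.coe_ne_top).comp
        (continuous_enorm.comp hφ)).lowerSemicontinuous
    · refine (ENNReal.continuous_const_mul ENNReal.coe_ne_top).comp_lowerSemicontinuous
        (LowerSemicontinuous.add ?_ ?_) fun _ _ h => mul_le_mul_right h _
      · exact hw.comp (continuous_subtype_val.comp continuous_fst)
      · exact hw.comp (continuous_subtype_val.comp continuous_snd)
  convert ((hlsc.isClosed_preimage (t : ℝ≥0∞)).isCompact).image
    ((UniformSpace.Completion.continuous_coe (M1 e)).comp hφ) using 1
  ext μ
  constructor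
  · intro hμ
    obtain ⟨σ, τ, h1, h2⟩ := exists_toM1_sub_eq_of_regularizer_le hp.le α hβ hμ
    exact ⟨(σ, τ), h2, h1⟩
  · rintro ⟨⟨σ, τ⟩, h, rfl⟩
    exact (regularizer_toM1_sub_le hp.le α β σ τ).trans h

theorem lowerSemicontinuous_regularizer (hK : ∀ r, IsCompact (Metric.closedBall e r)) (hp : 1 < p)
    (α : ℝ≥0) {β : ℝ≥0} (hβ : 0 < β) : LowerSemicontinuous (regularizer e p α β) := by
  refine lowerSemicontinuous_iff_isClosed_preimage.2 fun y => ?_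
  induction y with
  | top => simp
  | coe t => exact (isCompact_setOf_regularizer_le hK hp α hβ t).isClosed

end Compactness

end KRSpace

theorem mainTheorem2 {Z : Type*} [MetricSpace Z] [CompleteSpace Z]
    [TopologicalSpace.SeparableSpace Z] [LocallyCompactSpace Z]
    [MeasurableSpace Z] [BorelSpace Z] (hZ : IsGeodesicSpace Z)
    (e : Z) (p : ℝ) (hp : 1 < p) (α β : ℝ≥0) (hβ : 0 < β) :
    LowerSemicontinuous (KRSpace.regularizer e p α β) ∧
    (∀ t : ℝ≥0, IsCompact {μ : KRSpace.KRu e | KRSpace.regularizer e p α β μ ≤ t}) ∧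
    (∀ (H : Type*) [NormedAddCommGroup H] [InnerProductSpace ℝ H] [CompleteSpace H]
      (A : KRSpace.KRu e →L[ℝ] H) (F : H → EReal),
      IsProperFunctional F → IsConvexFunctional F → IsCoerciveFunctional F →
      LowerSemicontinuous F →
      ∃ μ₀ : KRSpace.KRu e, ∀ μ : KRSpace.KRu e,
        F (A μ₀) + (KRSpace.regularizer e p α β μ₀ : EReal) ≤
          F (A μ) + (KRSpace.regularizer e p α β μ : EReal)) := by
  have hK := hZ.isCompact_closedBall e
  have hlsc := KRSpace.lowerSemicontinuous_regularizer hK hp α hβ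
  have hcpt := KRSpace.isCompact_setOf_regularizer_le hK hp α hβ
  refine ⟨hlsc, hcpt, fun H _ _ _ A F hprop hconv hcoer hF => ?_⟩
  obtain ⟨m, hm⟩ := hconv.exists_forall_coe_le hprop hcoer hF
  exact exists_forall_add_le_of_isCompact_sublevel (fun μ => hm (A μ))
    (hF.comp A.continuous) hlsc hcpt
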